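/- An infinite-time Turing machine (ITTM) here has three one-way infinite tapes (input, scratch, output) over the alphabet $\{0,1\}$, one head that scans the cells in the same position of all three tapes, and finitely many states, among them a start state, a limit state and a halting state, which are distinct. It computes through ordinal stages: at successor stages it acts like an ordinary Turing machine (it rewrites the scanned cells, moves its head one cell left or right, where a left move from the leftmost cell has no effect, and changes its state); at limit stages each cell receives the $\limsup$ of its earlier values, the head is placed on the leftmost cell, and the machine enters the limit state. It computes a partial function from $\{0,1\}^{\mathbb N}$ to $\{0,1\}^{\mathbb N}$: the argument is written on the input tape, the other tapes being blank (all $0$), and the value is the content of the output tape when the machine first reaches the halting state; the function is undefined where the machine never halts. Let $IT\text{-}\mathcal C$ be the set of partial functions computed by some ITTM. For $n\in\mathbb N=\{0,1,2,\dots\}$ let $\widehat n\in\{0,1\}^{\mathbb N}$ consist of $n$ ones followed by zeros. For $f\in IT\text{-}\mathcal C$ let $f^*$ be the partial function from $\mathbb N$ to $\mathbb N$ with $f^*(n)=k$ if $f(\widehat n)=\widehat k$, and $f^*(n)$ undefined if there is no such $k$. A function $g:\mathbb N\to\mathbb N$ is called ITTM-computable if $g=f^*$ for some $f\in IT\text{-}\mathcal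 C$. Let $BB_\infty\text{-}n$ be the set of all $f\in IT\text{-}\mathcal C$ such that $f^*(0)$ is defined and $f$ is computed by an ITTM with at most $n$ non-halting, non-limit states, and define the infinitary busy beaver function $\Sigma_\infty:\mathbb N\to\mathbb N$ by \[\Sigma_\infty(n)=\max_{f\in BB_\infty\text{-}n} f^*(0),\] where the maximum is read as $0$ for $n=0$, when $BB_\infty\text{-}n$ is empty. Then $\Sigma_\infty$ is not ITTM-computable. -/

import Mathlib

/-- The three tapes. -/
inductive TapeName
  | input
  | scratch
  | output
  deriving DecidableEq

instance : Fintype TapeName :=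
  ⟨{TapeName.input, TapeName.scratch, TapeName.output}, by rintro (_ | _ | _) <;> simp⟩

/-- The content of one one-way infinite tape over the alphabet `{0, 1}` (`true` is `1`). -/
abbrev TapeContent : Type := ℕ → Bool

/-- Directions of a head move. -/
inductive HeadMove
  | left
  | right
  deriving DecidableEq

instance : Fintype HeadMove :=
  ⟨{HeadMove.left, HeadMove.right}, by rintro (_ | _) <;> simp⟩

/-- The states of a machine with `m` non-halting, non-limit states. -/
inductive MachineState (m : ℕ)
  | ordinary (i : Fin m)
  | limit
  | halt
  deriving DecidableEq, Fintype

/-- A three-tape infinite-time Turing machine with `m` non-halting, non-limit states.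
A single head scans the cells in the same position of all three tapes.  The start state is one
of the ordinary states.  The values of `trans` at the halting state are never used. -/
structure ITTM (m : ℕ) where
  start : Fin m
  trans : MachineState m → (TapeName → Bool) → MachineState m × (TapeName → Bool) × HeadMove

/-- A snapshot of a computation. -/
structure ITTMConfig (m : ℕ) where
  state : MachineState m
  head : ℕ
  tape : TapeName → TapeContent

namespace ITTM

variable {m : ℕ}

/-- The head moves one cell; a move to the left from the leftmost cell has no effect. -/
def moveHead : HeadMove → ℕ → ℕ
  | HeadMove.left, p => p - 1
  | HeadMove.right, p => p + 1

/-- The initial configuration: the given input on the input tape, the other tapes blank. -/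
def initial (M : ITTM m) (x : TapeContent) : ITTMConfig m where
  state := MachineState.ordinary M.start
  head := 0
  tape := fun t => match t with
    | TapeName.input => x
    | TapeName.scratch => fun _ => false
    | TapeName.output => fun _ => false

/-- One successor step: the scanned cells are overwritten and the head moves. -/
def step (M : ITTM m) (c : ITTMConfig m) : ITTMConfig m :=
  if c.state = MachineState.halt then c
  else
    let r := M.trans c.state (fun t => c.tape t c.head)
    { state := r.1
      head := moveHead r.2.2 c.head
      tape := fun t => Function.update (c.tape t) c.head (r.2.1 t) }

open Classical in
/-- The configuration at a limit stage `a`: the machine is in the limit state, its head is on the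
leftmost cell, and each cell holds the limsup of its earlier values, that is, it holds `1` if and
only if it has held `1` at stages cofinal in `a`. -/
noncomputable def limitConfig (a : Ordinal.{0}) (c : ∀ b : Ordinal.{0}, b < a → ITTMConfig m) :
    ITTMConfig m where
  state := MachineState.limit
  head := 0
  tape := fun t i => decide (∀ b, b < a → ∃ d, ∃ h : d < a, b ≤ d ∧ (c d h).tape t i = true)

/-- The configuration of `M` on input `x` at an ordinal stage.  Only the stages up to the first
one at which the machine is in the halting state are meaningful. -/
noncomputable def run (M : ITTM m) (x : TapeContent) (a : Ordinal.{0}) : ITTMConfig m :=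
  Ordinal.limitRecOn (motive := fun _ => ITTMConfig m) a (M.initial x)
    (fun _ c => M.step c) (fun b _ c => limitConfig b c)

theorem run_zero (M : ITTM m) (x : TapeContent) : M.run x 0 = M.initial x := by
  simp [run]

theorem run_succ (M : ITTM m) (x : TapeContent) (a : Ordinal.{0}) :
    M.run x (Order.succ a) = M.step (M.run x a) := by
  simp [run]

theorem run_limit (M : ITTM m) (x : TapeContent) (a : Ordinal.{0}) (ha : Order.IsSuccLimit a) :
    M.run x a = limitConfig a (fun b _ => M.run x b) := by
  unfold run
  rw [Ordinal.limitRecOn_limit _ _ _ _ ha]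

/-- The partial function on Cantor space computed by `M`: its value at `x` is the content of the
output tape at the first stage at which `M`, started on `x`, is in the halting state. -/
noncomputable def eval (M : ITTM m) : TapeContent →. TapeContent := fun x =>
  { Dom := ∃ a, (M.run x a).state = MachineState.halt
    get := fun _ =>
      (M.run x (sInf {a | (M.run x a).state = MachineState.halt})).tape TapeName.output }

end ITTM

/-- The unary code of `n`: ones on the first `n` cells and zeros on all other cells. -/
def unaryCode (n : ℕ) : TapeContent := fun i => decide (i < n)

theorem unaryCode_injective : Function.Injective unaryCode := by
  intro a b h
  have h1 := congrFun h a
  have h2 := congrFun h b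
  simp only [unaryCode, decide_eq_decide] at h1 h2
  omega

/-- The set of infinite-time computable (partial) functions on Cantor space. -/
def InfTimeComputable : Set (TapeContent →. TapeContent) :=
  {f | ∃ (m : ℕ) (M : ITTM m), M.eval = f}

/-- The partial function `f*` from `ℕ` to `ℕ` induced by a partial function `f` on Cantor space:
`f*(n) = k` if `f` maps the code of `n` to the code of `k`. -/
noncomputable def starFun (f : TapeContent →. TapeContent) : ℕ →. ℕ := fun n =>
  { Dom := ∃ k, unaryCode k ∈ f (unaryCode n)
    get := fun h => h.choose }

theorem mem_starFun {f : TapeContent →. TapeContent} {n k : ℕ} :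
    k ∈ starFun f n ↔ unaryCode k ∈ f (unaryCode n) := by
  constructor
  · rintro ⟨h, rfl⟩
    exact h.choose_spec
  · intro h
    have h' : ∃ k, unaryCode k ∈ f (unaryCode n) := ⟨k, h⟩
    exact ⟨h', unaryCode_injective (Part.mem_unique h'.choose_spec h)⟩

/-- A function from `ℕ` to `ℕ` is ITTM-computable if it is `f*` for an infinite-time computable
function `f`. -/
def ITTMComputable (g : ℕ → ℕ) : Prop :=
  ∃ f ∈ InfTimeComputable, starFun f = (g : ℕ →. ℕ)

/-- The set of infinite-time computable `f` such that `f*(0)` is defined and `f` is computable by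
a machine with at most `n` non-halting, non-limit states. -/
def infBB (n : ℕ) : Set (TapeContent →. TapeContent) :=
  {f | f ∈ InfTimeComputable ∧ (starFun f 0).Dom ∧ ∃ m ≤ n, ∃ M : ITTM m, M.eval = f}

/-- The set of values `f*(0)` over which the infinitary busy beaver function maximizes. -/
def infScores (n : ℕ) : Set ℕ := {k | ∃ f ∈ infBB n, k ∈ starFun f 0}

/-- The infinitary busy beaver function.  For `n ≥ 1` the supremum is a maximum
(`sigmaInf_isGreatest`); for `n = 0` there is no machine and the value is `0`. -/
noncomputable def sigmaInf (n : ℕ) : ℕ := sSup (infScores n)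

instance (m : ℕ) : Finite (ITTM m) :=
  Finite.of_injective (fun M : ITTM m => (M.start, M.trans)) (by
    rintro ⟨a, b⟩ ⟨c, d⟩ h
    simpa using h)

theorem infScores_finite (n : ℕ) : (infScores n).Finite := by
  have hfin : (⋃ m ∈ Set.Iic n, Set.range (fun M : ITTM m => M.eval)).Finite :=
    (Set.finite_Iic n).biUnion fun m _ => Set.finite_range _
  refine (hfin.biUnion (t := fun f => {k | k ∈ starFun f 0}) fun f _ => ?_).subset ?_
  · exact Set.Subsingleton.finite fun a ha b hb => Part.mem_unique ha hb
  · rintro k ⟨f, ⟨-, -, m, hm, M, hM⟩, hk⟩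
    simp only [Set.mem_iUnion]
    exact ⟨f, ⟨m, hm, M, hM⟩, hk⟩

theorem infScores_nonempty {n : ℕ} (hn : 1 ≤ n) : (infScores n).Nonempty := by
  let M : ITTM 1 := ⟨0, fun _ _ => (MachineState.halt, fun _ => false, HeadMove.left)⟩
  have hsucc : Order.succ (0 : Ordinal.{0}) = 1 := by simp
  have h0 : (M.run (unaryCode 0) 0).state ≠ MachineState.halt := by
    simp [ITTM.run_zero, ITTM.initial]
  have h1 : (M.run (unaryCode 0) 1).state = MachineState.halt := by
    rw [← hsucc, ITTM.run_succ, ITTM.run_zero]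
    simp [ITTM.step, ITTM.initial, M]
  have hs : sInf {a | (M.run (unaryCode 0) a).state = MachineState.halt} = 1 := by
    refine le_antisymm (csInf_le' h1) (Order.one_le_iff_pos.2 (pos_iff_ne_zero.2 fun h => h0 ?_))
    have := csInf_mem (s := {a | (M.run (unaryCode 0) a).state = MachineState.halt}) ⟨1, h1⟩
    rwa [h] at this
  have hk : 0 ∈ starFun M.eval 0 := by
    rw [mem_starFun]
    refine ⟨⟨1, h1⟩, ?_⟩
    change (M.run (unaryCode 0) (sInf _)).tape TapeName.output = _
    rw [hs, ← hsucc, ITTM.run_succ, ITTM.run_zero]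
    funext i
    simp [ITTM.step, ITTM.initial, M, unaryCode]
  exact ⟨0, M.eval, ⟨⟨1, M, rfl⟩, Part.dom_iff_mem.2 ⟨0, hk⟩, 1, hn, M, rfl⟩, hk⟩

theorem sigmaInf_isGreatest {n : ℕ} (hn : 1 ≤ n) : IsGreatest (infScores n) (sigmaInf n) :=
  ⟨Nat.sSup_mem (infScores_nonempty hn) (infScores_finite n).bddAbove,
    fun _ hk => le_csSup (infScores_finite n).bddAbove hk⟩

/-! Suppose a machine `M` with `m` ordinary states computes `sigmaInf`, and put `k = m + 4`. From
`M` one builds `doublingMachine M k`, which starts on blank tapes, writes the code of `2k` on its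
input tape, runs `M`, and lengthens the resulting output by one cell. It has `m + k + 4 = 2k`
ordinary states, so it competes for `sigmaInf (2k)` yet outputs `sigmaInf (2k) + 1`.

The saving is that `2k` ones cost only `k` appending states: the states are traversed twice, and a
scratch cell records which pass is running. Three facts carry the proof: `reaches_simConfig_initial`
(the preparation is finite and leaves exactly the initial configuration of `M`),
`run_add_eq_simConfig` (shifting stages by a finite ordinal preserves the whole transfinite run) and
`exists_iterate_seek` (the output is extended wherever `M` left its head). -/

namespace ITTM

variable {m : ℕ}

theorem run_add_nat (M : ITTM m) (x : TapeContent) (a : Ordinal.{0}) (j : ℕ) :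
    M.run x (a + j) = M.step^[j] (M.run x a) := by
  induction j with
  | zero => simp
  | succ j ih =>
    rw [Function.iterate_succ_apply', ← ih, ← run_succ]
    congr 1
    push_cast
    rw [← add_assoc, Order.succ_eq_add_one]

theorem step_of_halt (M : ITTM m) {c : ITTMConfig m} (h : c.state = MachineState.halt) :
    M.step c = c := by
  simp [step, h]

theorem iterate_step_of_halt (M : ITTM m) {c : ITTMConfig m} (h : c.state = MachineState.halt)
    (j : ℕ) : M.step^[j] c = c :=
  Function.iterate_fixed (M.step_of_halt h) j

/-- A computation that has not halted up to stage `a` and halts finitely many steps later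
has as its value the output tape at that later stage. -/
theorem mem_eval_of_iterate (M : ITTM m) {x y : TapeContent} {a : Ordinal.{0}} {j : ℕ}
    (hlt : ∀ b ≤ a, (M.run x b).state ≠ MachineState.halt)
    (hj : (M.step^[j] (M.run x a)).state = MachineState.halt)
    (hy : (M.step^[j] (M.run x a)).tape TapeName.output = y) : y ∈ M.eval x := by
  have hmem : a + j ∈ {b | (M.run x b).state = MachineState.halt} := by
    simpa [run_add_nat] using hj
  refine ⟨⟨_, hmem⟩, ?_⟩
  change (M.run x (sInf {b | (M.run x b).state = MachineState.halt})).tape TapeName.output = y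
  have hs := csInf_mem (s := {b | (M.run x b).state = MachineState.halt}) ⟨_, hmem⟩
  have hle := csInf_le' hmem
  generalize sInf {b | (M.run x b).state = MachineState.halt} = s at hs hle
  have has : a ≤ s := le_of_not_ge fun h => hlt s h hs
  obtain ⟨d, rfl⟩ := exists_add_of_le has
  have hd : d ≤ j := le_of_add_le_add_left hle
  obtain ⟨i, rfl⟩ := Ordinal.lt_omega0.1 (hd.trans_lt (Ordinal.natCast_lt_omega0 j))
  have hij : i ≤ j := by exact_mod_cast hd
  obtain ⟨l, rfl⟩ := Nat.exists_eq_add_of_le hij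
  rw [Set.mem_ofPred_eq, run_add_nat] at hs
  rw [run_add_nat, ← hy, add_comm i l, Function.iterate_add_apply, iterate_step_of_halt M hs]

/-- `c'` is reached from `c` after finitely many steps. -/
def Reaches (M : ITTM m) (c c' : ITTMConfig m) : Prop := ∃ j, M.step^[j] c = c'

theorem Reaches.refl (M : ITTM m) (c : ITTMConfig m) : M.Reaches c c := ⟨0, rfl⟩

theorem Reaches.trans {M : ITTM m} {c₁ c₂ c₃ : ITTMConfig m} (h₁ : M.Reaches c₁ c₂)
    (h₂ : M.Reaches c₂ c₃) : M.Reaches c₁ c₃ := by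
  obtain ⟨i, rfl⟩ := h₁
  obtain ⟨j, rfl⟩ := h₂
  exact ⟨j + i, Function.iterate_add_apply _ _ _ _⟩

theorem Reaches.head {M : ITTM m} {c c₁ c₂ : ITTMConfig m} (h : M.step c = c₁)
    (h₁ : M.Reaches c₁ c₂) : M.Reaches c c₂ :=
  Reaches.trans ⟨1, h⟩ h₁

end ITTM

/-! ### Unary codes and triples of tapes. -/

theorem update_unaryCode_self (n : ℕ) :
    Function.update (unaryCode n) n true = unaryCode (n + 1) := by
  funext i
  by_cases h : i = n
  · subst h; simp [unaryCode]
  · rw [Function.update_of_ne h]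
    simp only [unaryCode, decide_eq_decide]
    omega

theorem update_unaryCode_one :
    Function.update (unaryCode 1) 0 false = unaryCode 0 := by
  funext i
  by_cases h : i = 0
  · subst h; simp [unaryCode]
  · rw [Function.update_of_ne h]
    simp only [unaryCode, decide_eq_decide]
    omega

/-- Assigns to the three tapes the three given values. -/
def onTapes {α : Type} (i s o : α) : TapeName → α
  | TapeName.input => i
  | TapeName.scratch => s
  | TapeName.output => o

@[simp]
theorem onTapes_input {α : Type} (i s o : α) : onTapes i s o TapeName.input = i := rfl

@[simp]
theorem onTapes_scratch {α : Type} (i s o : α) : onTapes i s o TapeName.scratch = s := rfl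

@[simp]
theorem onTapes_output {α : Type} (i s o : α) : onTapes i s o TapeName.output = o := rfl

theorem update_onTapes (i s o : TapeContent) (p : ℕ) (a b c : Bool) :
    (fun t => Function.update (onTapes i s o t) p (onTapes a b c t)) =
      onTapes (Function.update i p a) (Function.update s p b) (Function.update o p c) := by
  funext t
  cases t <;> rfl

/-! ### The doubling machine. -/

/-- The ordinary states of the machine that writes the code of `2 * k` on its input tape,
simulates a machine with `m` ordinary states and finally appends a `1` to the output. -/
inductive DoublingState (m k : ℕ)
  | sim (i : Fin m)
  | append (i : Fin k)
  | start
  | rewind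
  | seek
  | extend

def doublingStateEquivSum (m k : ℕ) : DoublingState m k ≃ (Fin m ⊕ Fin k) ⊕ Fin 4 where
  toFun
    | DoublingState.sim i => Sum.inl (Sum.inl i)
    | DoublingState.append i => Sum.inl (Sum.inr i)
    | DoublingState.start => Sum.inr 0
    | DoublingState.rewind => Sum.inr 1
    | DoublingState.seek => Sum.inr 2
    | DoublingState.extend => Sum.inr 3
  invFun
    | Sum.inl (Sum.inl i) => DoublingState.sim i
    | Sum.inl (Sum.inr i) => DoublingState.append i
    | Sum.inr 0 => DoublingState.start
    | Sum.inr 1 => DoublingState.rewind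
    | Sum.inr 2 => DoublingState.seek
    | Sum.inr 3 => DoublingState.extend
  left_inv := by rintro (_ | _ | _ | _ | _ | _) <;> rfl
  right_inv := by
    rintro ((_ | _) | i)
    · rfl
    · rfl
    · fin_cases i <;> rfl

def doublingStateEquiv (m k : ℕ) : DoublingState m k ≃ Fin (m + k + 4) :=
  (doublingStateEquivSum m k).trans
    ((Equiv.sumCongr finSumFinEquiv (Equiv.refl _)).trans finSumFinEquiv)

namespace DoublingState

variable {m k : ℕ}

/-- The machine state that corresponds to a doubling state. -/
def toState (s : DoublingState m k) : MachineState (m + k + 4) :=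
  MachineState.ordinary (doublingStateEquiv m k s)

/-- The `i`-th appending state; rewinding follows the last one. -/
def appendState (m k i : ℕ) : MachineState (m + k + 4) :=
  if h : i < k then (append ⟨i, h⟩ : DoublingState m k).toState
  else (rewind : DoublingState m k).toState

/-- The image of a state of the simulated machine: halting becomes seeking. -/
def simState (k : ℕ) : MachineState m → MachineState (m + k + 4)
  | MachineState.ordinary i => (sim i : DoublingState m k).toState
  | MachineState.limit => MachineState.limit
  | MachineState.halt => (seek : DoublingState m k).toState

theorem toState_ne_halt (s : DoublingState m k) : s.toState ≠ MachineState.halt := by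
  simp [toState]

theorem simState_ne_halt (s : MachineState m) : simState k s ≠ MachineState.halt := by
  cases s <;> simp [simState, toState]

/-- The image of a configuration of the simulated machine. -/
def simConfig (k : ℕ) (c : ITTMConfig m) : ITTMConfig (m + k + 4) :=
  ⟨simState k c.state, c.head, c.tape⟩

theorem simConfig_state_ne_halt (c : ITTMConfig m) :
    (simConfig k c).state ≠ MachineState.halt :=
  simState_ne_halt c.state

/-- The transition from a state that simulates a state of `M`. -/
def simTrans (M : ITTM m) (k : ℕ) (s : MachineState m) (v : TapeName → Bool) :
    MachineState (m + k + 4) × (TapeName → Bool) × HeadMove :=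
  (simState k (M.trans s v).1, (M.trans s v).2)

/-- During preparation a `1` on output cell 0 marks the left end of the tape, and scratch cell 0 is
`1` exactly in the second pass. Both are erased before `M` starts. Left moves made on cell 0 leave
the head there. -/
def trans (M : ITTM m) (k : ℕ) (s : DoublingState m k) (v : TapeName → Bool) :
    MachineState (m + k + 4) × (TapeName → Bool) × HeadMove :=
  match s with
  | sim i => simTrans M k (MachineState.ordinary i) v
  | append i =>
    if v TapeName.input then ((append i : DoublingState m k).toState, v, HeadMove.right)
    else (appendState m k (i + 1), onTapes true (v TapeName.scratch) (v TapeName.output),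
      HeadMove.right)
  | start => (appendState m k 0, onTapes false false true, HeadMove.left)
  | rewind =>
    if v TapeName.output then
      if v TapeName.scratch then
        ((sim M.start : DoublingState m k).toState, onTapes (v TapeName.input) false false,
          HeadMove.left)
      else (appendState m k 0, onTapes (v TapeName.input) true true, HeadMove.left)
    else ((rewind : DoublingState m k).toState, v, HeadMove.left)
  | seek =>
    if v TapeName.output then ((extend : DoublingState m k).toState, v, HeadMove.right)
    else ((seek : DoublingState m k).toState, v, HeadMove.left)
  | extend =>
    if v TapeName.output then ((extend : DoublingState m k).toState, v, HeadMove.right)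
    else (MachineState.halt, onTapes (v TapeName.input) (v TapeName.scratch) true,
      HeadMove.left)

end DoublingState

open DoublingState

/-- On blank input this machine writes the code of `2 * k` on its input tape in two passes
through `k` appending states, runs `M`, and appends a `1` to the output. -/
def doublingMachine {m : ℕ} (M : ITTM m) (k : ℕ) : ITTM (m + k + 4) where
  start := doublingStateEquiv m k DoublingState.start
  trans := fun s v => match s with
    | MachineState.ordinary i => ((doublingStateEquiv m k).symm i).trans M k v
    -- Only the simulation of `M` passes through limit stages, so the limit state can be shared with
    -- `M`.
    | MachineState.limit => simTrans M k MachineState.limit v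
    | MachineState.halt => simTrans M k MachineState.halt v

/-! ### Preparation of the input. -/

namespace doublingMachine

variable {m : ℕ} (M : ITTM m) (k : ℕ)

theorem step_toState (s : DoublingState m k) (p : ℕ) (T : TapeName → TapeContent) :
    (doublingMachine M k).step ⟨s.toState, p, T⟩ =
      let r := s.trans M k (fun t => T t p)
      ⟨r.1, ITTM.moveHead r.2.2 p, fun t => Function.update (T t) p (r.2.1 t)⟩ := by
  rw [ITTM.step, if_neg s.toState_ne_halt]
  simp [toState, doublingMachine]

theorem step_simConfig {c : ITTMConfig m} (hc : c.state ≠ MachineState.halt) :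
    (doublingMachine M k).step (simConfig k c) = simConfig k (M.step c) := by
  rcases c with ⟨s, p, T⟩
  cases s with
  | ordinary i =>
    rw [simConfig, simState, step_toState, ITTM.step, if_neg hc]
    rfl
  | limit =>
    rw [ITTM.step, ITTM.step, if_neg hc, if_neg]
    · rfl
    · exact simConfig_state_ne_halt _
  | halt => exact absurd rfl hc

/-- A configuration whose tapes hold unary codes. -/
def unaryConfig (s : MachineState (m + k + 4)) (p a b c : ℕ) : ITTMConfig (m + k + 4) :=
  ⟨s, p, onTapes (unaryCode a) (unaryCode b) (unaryCode c)⟩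

theorem reaches_append (i : ℕ) (hi : i < k) (b c d p : ℕ) :
    (doublingMachine M k).Reaches
      (unaryConfig k (appendState m k i) p (p + d) b c)
      (unaryConfig k (appendState m k (i + 1)) (p + d + 1) (p + d + 1) b c) := by
  induction d generalizing p with
  | zero =>
    refine ITTM.Reaches.head ?_ (ITTM.Reaches.refl _ _)
    rw [unaryConfig, appendState, dif_pos hi, step_toState]
    have h : unaryCode p p = false := by simp [unaryCode]
    simp [DoublingState.trans, h, ITTM.moveHead, update_onTapes,
      update_unaryCode_self, unaryConfig]
  | succ d ih =>
    have hd : p + (d + 1) = p + 1 + d := by omega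
    rw [hd]
    refine ITTM.Reaches.head ?_ (ih (p + 1))
    rw [unaryConfig, appendState, dif_pos hi, step_toState]
    have h : unaryCode (p + 1 + d) p = true := by simp [unaryCode]; omega
    simp [DoublingState.trans, h, ITTM.moveHead, unaryConfig]

theorem reaches_append_all (b c n : ℕ) (hk : 0 < k) :
    (doublingMachine M k).Reaches
      (unaryConfig k (appendState m k 0) 0 n b c)
      (unaryConfig k (DoublingState.rewind : DoublingState m k).toState (n + k) (n + k) b c) := by
  have key : ∀ i < k, (doublingMachine M k).Reaches
      (unaryConfig k (appendState m k 0) 0 n b c)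
      (unaryConfig k (appendState m k (i + 1)) (n + (i + 1)) (n + (i + 1)) b c) := by
    intro i hi
    induction i with
    | zero => simpa using reaches_append M k 0 hi b c n 0
    -- Every appending state after the first starts just past the block of ones, hence distance `0`.
    | succ i ih => exact (ih (by omega)).trans (reaches_append M k (i + 1) hi b c 0 _)
  have := key (k - 1) (by omega)
  rw [Nat.sub_add_cancel hk] at this
  simpa [appendState] using this

theorem reaches_rewind (a b p : ℕ) :
    (doublingMachine M k).Reaches
      (unaryConfig k (DoublingState.rewind : DoublingState m k).toState p a b 1)
      (unaryConfig k (DoublingState.rewind : DoublingState m k).toState 0 a b 1) := by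
  induction p with
  | zero => exact ITTM.Reaches.refl _ _
  | succ p ih =>
    refine ITTM.Reaches.head ?_ ih
    rw [unaryConfig, step_toState]
    have h : unaryCode 1 (p + 1) = false := by simp [unaryCode]
    simp [DoublingState.trans, h, ITTM.moveHead, unaryConfig]

theorem reaches_simConfig_initial (hk : 0 < k) :
    (doublingMachine M k).Reaches ((doublingMachine M k).initial (unaryCode 0))
      (simConfig k (M.initial (unaryCode (k + k)))) := by
  have hblank : (fun _ => false) = unaryCode 0 := by funext i; simp [unaryCode]
  have hinit : ∀ {l : ℕ} (N : ITTM l) (x : TapeContent), N.initial x =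
      ⟨MachineState.ordinary N.start, 0, onTapes x (unaryCode 0) (unaryCode 0)⟩ := by
    intro l N x
    rw [ITTM.initial, hblank]
    congr 1
  have h0 : unaryCode 0 0 = false := rfl
  have h1 : unaryCode 1 0 = true := rfl
  have h01 : Function.update (unaryCode 0) 0 true = unaryCode 1 := update_unaryCode_self 0
  have h00 : Function.update (unaryCode 0) 0 false = unaryCode 0 := Function.update_eq_self 0 _
  have h11 : Function.update (unaryCode 1) 0 true = unaryCode 1 := Function.update_eq_self 0 _
  have hstart : (doublingMachine M k).step ((doublingMachine M k).initial (unaryCode 0)) =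
      unaryConfig k (appendState m k 0) 0 0 0 1 := by
    rw [hinit]
    refine (step_toState M k DoublingState.start _ _).trans ?_
    simp [DoublingState.trans, ITTM.moveHead, update_onTapes, h01, h00, unaryConfig]
  have hmid : (doublingMachine M k).step
      (unaryConfig k (DoublingState.rewind : DoublingState m k).toState 0 k 0 1) =
      unaryConfig k (appendState m k 0) 0 k 1 1 := by
    rw [unaryConfig, step_toState]
    simp [DoublingState.trans, ITTM.moveHead, update_onTapes, h0, h1, h01, h11, unaryConfig]
  have hend : (doublingMachine M k).step
      (unaryConfig k (DoublingState.rewind : DoublingState m k).toState 0 (k + k) 1 1) =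
      simConfig k (M.initial (unaryCode (k + k))) := by
    rw [unaryConfig, step_toState, hinit]
    simp [DoublingState.trans, ITTM.moveHead, update_onTapes, h1, update_unaryCode_one,
      simConfig, simState]
  refine ITTM.Reaches.head hstart ?_
  have first := reaches_append_all M k 0 1 0 hk
  rw [zero_add] at first
  refine (first.trans (reaches_rewind M k k 0 k)).trans (ITTM.Reaches.head hmid ?_)
  exact ((reaches_append_all M k 1 1 k hk).trans (reaches_rewind M k (k + k) 1 _)).trans
    (ITTM.Reaches.head hend (ITTM.Reaches.refl _ _))

/-! ### Transfinite simulation. -/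

/-- Once the input is prepared, the machine follows `M` up to the stage at which `M` halts. -/
theorem run_add_eq_simConfig {x y : TapeContent} {j : ℕ}
    (hj : (doublingMachine M k).run x j = simConfig k (M.initial y)) (a : Ordinal.{0})
    (ha : ∀ b < a, (M.run y b).state ≠ MachineState.halt) :
    (doublingMachine M k).run x (j + a) = simConfig k (M.run y a) := by
  induction a using Ordinal.limitRecOn with
  | zero => rw [add_zero, hj, ITTM.run_zero]
  | add_one a ih =>
    have hlt : a < Order.succ a := Order.lt_succ a
    rw [← Order.succ_eq_add_one] at ha ⊢
    rw [Order.succ_eq_add_one, ← add_assoc, ← Order.succ_eq_add_one, ← Order.succ_eq_add_one, ITTM.run_succ, ITTM.run_succ, ih fun b hb => ha b (hb.trans hlt),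
      step_simConfig M k (ha a hlt)]
  | limit a hlim ih =>
    have hsim : ∀ d < a, (doublingMachine M k).run x (j + d) = simConfig k (M.run y d) :=
      fun d hd => ih d hd fun b hb => ha b (hb.trans hd)
    rw [ITTM.run_limit _ _ _ (Ordinal.isSuccLimit_add _ hlim), ITTM.run_limit _ _ _ hlim]
    simp only [simConfig, ITTM.limitConfig, simState, ITTMConfig.mk.injEq, true_and]
    funext t i
    rw [decide_eq_decide]
    -- Both limsups agree because the stages `j + d` with `d < a` are cofinal in `j + a`; the
    -- preparation stages do not matter.
    constructor
    · intro h b hb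
      obtain ⟨d, hd, hbd, hv⟩ := h (j + b) (by gcongr)
      obtain ⟨e, rfl⟩ := exists_add_of_le (le_self_add.trans hbd)
      have he : e < a := lt_of_add_lt_add_left hd
      rw [hsim e he] at hv
      exact ⟨e, he, le_of_add_le_add_left hbd, hv⟩
    · intro h b hb
      -- For `b` inside the preparation the ordinal difference is `0`, so any later stage of `M`
      -- serves.
      have hsub : b - j < a := by
        rcases le_total (j : Ordinal.{0}) b with hjb | hjb
        · obtain ⟨e, rfl⟩ := exists_add_of_le hjb
          rw [Ordinal.add_sub_cancel]
          exact lt_of_add_lt_add_left hb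
        · rw [Ordinal.sub_eq_zero_iff_le.2 hjb]
          exact hlim.bot_lt
      obtain ⟨d, hd, hbd, hv⟩ := h _ hsub
      refine ⟨j + d, by gcongr, ?_, ?_⟩
      · exact (Ordinal.le_add_sub b j).trans (by gcongr)
      · rw [hsim d hd]
        exact hv

/-! ### Appending a one to the output. -/

theorem exists_iterate_extend (T : TapeName → TapeContent) (n p d : ℕ) (hd : p + d = n)
    (hT : T TapeName.output = unaryCode n) :
    ∃ j, ((doublingMachine M k).step^[j]
        ⟨(DoublingState.extend : DoublingState m k).toState, p, T⟩).state = MachineState.halt ∧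
      ((doublingMachine M k).step^[j]
        ⟨(DoublingState.extend : DoublingState m k).toState, p, T⟩).tape TapeName.output =
          unaryCode (n + 1) := by
  induction d generalizing p with
  | zero =>
    obtain rfl : p = n := by omega
    refine ⟨1, ?_⟩
    have h : unaryCode p p = false := by simp [unaryCode]
    rw [Function.iterate_one, step_toState]
    simp [DoublingState.trans, hT, h, update_unaryCode_self]
  | succ d ih =>
    obtain ⟨j, hj⟩ := ih (p + 1) (by omega)
    refine ⟨j + 1, ?_⟩
    have h : unaryCode n p = true := by simp [unaryCode]; omega
    rw [Function.iterate_succ_apply, step_toState]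
    simpa [DoublingState.trans, hT, h, ITTM.moveHead] using hj

/-- The head may stand anywhere when `M` halts, so it first goes left until it meets a one. On an
all-zero output it would stay on cell 0 forever, which is why `n` must be positive. -/
theorem exists_iterate_seek (T : TapeName → TapeContent) (n p : ℕ) (hn : 0 < n)
    (hT : T TapeName.output = unaryCode n) :
    ∃ j, ((doublingMachine M k).step^[j]
        ⟨(DoublingState.seek : DoublingState m k).toState, p, T⟩).state = MachineState.halt ∧
      ((doublingMachine M k).step^[j]
        ⟨(DoublingState.seek : DoublingState m k).toState, p, T⟩).tape TapeName.output =
          unaryCode (n + 1) := by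
  induction p with
  | zero =>
    obtain ⟨j, hj⟩ := exists_iterate_extend M k T n 1 (n - 1) (by omega) hT
    refine ⟨j + 1, ?_⟩
    have h : unaryCode n 0 = true := by simp [unaryCode]; omega
    rw [Function.iterate_succ_apply, step_toState]
    simpa [DoublingState.trans, hT, h, ITTM.moveHead] using hj
  | succ p ih =>
    by_cases hp : p + 1 < n
    · obtain ⟨j, hj⟩ := exists_iterate_extend M k T n (p + 2) (n - (p + 2)) (by omega) hT
      refine ⟨j + 1, ?_⟩
      have h : unaryCode n (p + 1) = true := by simp [unaryCode]; omega
      rw [Function.iterate_succ_apply, step_toState]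
      simpa [DoublingState.trans, hT, h, ITTM.moveHead] using hj
    · obtain ⟨j, hj⟩ := ih
      refine ⟨j + 1, ?_⟩
      have h : unaryCode n (p + 1) = false := by simp [unaryCode]; omega
      rw [Function.iterate_succ_apply, step_toState]
      simpa [DoublingState.trans, hT, h, ITTM.moveHead] using hj

/-- If `M` maps the code of `2 * k` to the code of a positive `n`, then on blank input the
doubling machine outputs the code of `n + 1`. -/
theorem mem_eval (hk : 0 < k) {n : ℕ} (hn : 0 < n)
    (h : unaryCode n ∈ M.eval (unaryCode (k + k))) :
    unaryCode (n + 1) ∈ (doublingMachine M k).eval (unaryCode 0) := by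
  obtain ⟨hdom, hval⟩ := h
  obtain ⟨i, hi⟩ := reaches_simConfig_initial M k hk
  have hi' : (doublingMachine M k).run (unaryCode 0) i =
      simConfig k (M.initial (unaryCode (k + k))) := by
    rw [← hi, ← ITTM.run_zero, ← ITTM.run_add_nat, zero_add]
  change (M.run _ (sInf {b | (M.run (unaryCode (k + k)) b).state =
    MachineState.halt})).tape TapeName.output = unaryCode n at hval
  have hs := csInf_mem (s := {b | (M.run (unaryCode (k + k)) b).state = MachineState.halt}) hdom
  have hmin : ∀ b < sInf {b | (M.run (unaryCode (k + k)) b).state = MachineState.halt},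
      (M.run (unaryCode (k + k)) b).state ≠ MachineState.halt :=
    fun b hb hhalt => notMem_of_lt_csInf' hb hhalt
  generalize sInf {b | (M.run (unaryCode (k + k)) b).state = MachineState.halt} = s
    at hval hs hmin
  have hsim : ∀ d ≤ s, (doublingMachine M k).run (unaryCode 0) (i + d) =
      simConfig k (M.run (unaryCode (k + k)) d) :=
    fun d hd => run_add_eq_simConfig M k hi' d fun b hb => hmin b (hb.trans_le hd)
  have hseek : (doublingMachine M k).run (unaryCode 0) (i + s) =
      ⟨(DoublingState.seek : DoublingState m k).toState, (M.run (unaryCode (k + k)) s).head,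
        (M.run (unaryCode (k + k)) s).tape⟩ := by
    rw [hsim s le_rfl, simConfig, show (M.run (unaryCode (k + k)) s).state = _ from hs]
    rfl
  obtain ⟨j, hj, hy⟩ := exists_iterate_seek M k _ n (M.run (unaryCode (k + k)) s).head hn hval
  rw [← hseek] at hj hy
  refine ITTM.mem_eval_of_iterate _ (fun b hb hhalt => ?_) hj hy
  rcases le_total (i : Ordinal.{0}) b with hib | hib
  · obtain ⟨d, rfl⟩ := exists_add_of_le hib
    rw [hsim d (le_of_add_le_add_left hb)] at hhalt
    exact simConfig_state_ne_halt _ hhalt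
  · obtain ⟨b, rfl⟩ := Ordinal.lt_omega0.1 (hib.trans_lt (Ordinal.natCast_lt_omega0 i))
    have hbi : b ≤ i := by exact_mod_cast hib
    obtain ⟨l, rfl⟩ := Nat.exists_eq_add_of_le hbi
    -- A halt during preparation would persist to stage `i`, where the state is a simulated one.
    have hrun := ITTM.run_add_nat (doublingMachine M k) (unaryCode 0) b l
    rw [ITTM.iterate_step_of_halt _ hhalt] at hrun
    push_cast at hi'
    rw [← hrun, hi'] at hhalt
    exact simConfig_state_ne_halt _ hhalt

end doublingMachine

/-! ### The contradiction. -/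

theorem mem_infScores {n m : ℕ} (hm : m ≤ n) (M : ITTM m) {c : ℕ}
    (h : unaryCode c ∈ M.eval (unaryCode 0)) : c ∈ infScores n := by
  have hc : c ∈ starFun M.eval 0 := mem_starFun.2 h
  exact ⟨M.eval, ⟨⟨m, M, rfl⟩, Part.dom_iff_mem.2 ⟨c, hc⟩, m, hm, M, rfl⟩, hc⟩

/-- Supplies the nonempty output that `doublingMachine.mem_eval` needs: one state suffices to write
a single `1` and halt. -/
theorem sigmaInf_pos {n : ℕ} (hn : 1 ≤ n) : 0 < sigmaInf n := by
  let M : ITTM 1 := ⟨0, fun _ _ => (MachineState.halt, fun _ => true, HeadMove.left)⟩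
  refine (sigmaInf_isGreatest hn).2 (mem_infScores hn M (c := 1) ?_)
  refine M.mem_eval_of_iterate (a := 0) (j := 1) ?_ ?_ ?_
  · intro b hb
    rw [nonpos_iff_eq_zero.1 hb, ITTM.run_zero]
    simp [ITTM.initial]
  · simp [ITTM.run_zero, ITTM.step, ITTM.initial, M]
  · rw [Function.iterate_one, ITTM.run_zero, ← update_unaryCode_self 0]
    funext i
    simp [ITTM.step, ITTM.initial, M, unaryCode, Function.update_apply]

theorem corollary1 : ¬ ITTMComputable sigmaInf := by
  rintro ⟨f, ⟨m, M, rfl⟩, hf⟩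
  have hN : 1 ≤ m + 4 + (m + 4) := by omega
  have hmem : sigmaInf (m + 4 + (m + 4)) ∈ starFun M.eval (m + 4 + (m + 4)) := by
    rw [hf]
    exact Part.mem_some _
  -- With `k = m + 4` the number of states `m + k + 4` equals the argument `k + k`.
  have hval := doublingMachine.mem_eval M (m + 4) (by omega) (sigmaInf_pos hN)
    (mem_starFun.1 hmem)
  have hle := (sigmaInf_isGreatest hN).2 (mem_infScores (by omega) _ hval)
  omega
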